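/- Let $\mathbb{S}\subset\mathbb{R}$ be a finite set and let $Y=(Y_t)_{t\ge 0}$ be a càdlàg continuous-time Markov chain on $\mathbb{S}$ with transition rate matrix $G=(G(x,z))_{x,z\in\mathbb{S}}$, i.e. $G(x,z)\ge 0$ for $z\ne x$, $G(x,x)=-\sum_{z\ne x}G(x,z)$, and the transition function of $Y$ is $e^{tG}$. For $x\le y$ in $\mathbb{S}$, conditioning on $Y_0=x,\ \overline Y_0=y$ means that $Y$ starts at $x$ and the running maximum is $\overline Y_t=y\vee\sup_{0\le u\le t}Y_u$; write $\mathbb{E}_x[\cdot]=\mathbb{E}[\cdot\mid Y_0=x,\overline Y_0=x]$. For $A\subseteq\mathbb{R}$ let $T_A=\inf\{t>0: Y_t\notin A\}$ (with $\inf\emptyset=\infty$), and put $T_r^+=T_{(-\infty,r]}$, $T_\ell^-=T_{(\ell,\infty)}$. Fix $a>0$ and $f:\mathbb{S}\to\mathbb{R}$, let $\tau_a=\inf\{t\ge 0:\overline Y_t-Y_t\ge a\}$, and let $k:\mathbb{S}^2\to\mathbb{C}$ satisfy $\Re k(x,y)\ge 0$ for all $x,y\in\mathbb{S}$. Define $$C(k,x)=\mathbb{E}_x\Big[e^{-\int_0^{\tau_a}k(Y_s,\overline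 Y_s)\,ds}\,\mathbf 1_{\{\tau_a<\infty\}}f(Y_{\tau_a})\Big],$$ $$P_A(\kappa,x;h)=\mathbb{E}\Big[e^{-\int_0^{T_A}\kappa(Y_s)\,ds}\,\mathbf 1_{\{T_A<\infty\}}h(Y_{T_A})\,\Big|\,Y_0=x\Big],\qquad \kappa:\mathbb{S}\to\mathbb{C},\ h:\mathbb{S}\to\mathbb{R},$$ $$S_{(\ell,r]}(k,x,y;g)=\mathbb{E}\Big[e^{-\int_0^{T_r^+}k(Y_s,\overline Y_s)\,ds}\,\mathbf 1_{\{T_\ell^->T_r^+\}}g(Y_{T_r^+})\,\Big|\,Y_0=x,\overline Y_0=y\Big],\qquad g:\mathbb{S}\to\mathbb{R}.$$ Then the random variables whose expectations occur below are integrable, and the following hold. (i) For every $x\in\mathbb{S}$, $$C(k,x)=P_{(x-a,x]}\big(k(\cdot,x),x;f(\cdot)\mathbf 1_{\{\cdot\le x-a\}}\big)+\sum_{z\in\mathbb{S},\,z>x}S_{(x-a,x]}\big(k,x,x;\mathbf 1_{\{\cdot=z\}}\big)\,C(k,z).$$ (ii) For all reals $\ell<r$, all $g:\mathbb{S}\to\mathbb{R}$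 and all $x,y\in\mathbb{S}$ with $x\le y$, $$\begin{cases}k(x,y)\,S_{(\ell,r]}(k,x,y;g)-\sum_{z\in\mathbb{S}}G(x,z)\,S_{(\ell,r]}(k,z,y\vee z;g)=0,& x\in(\ell,r],\\ S_{(\ell,r]}(k,x,y;g)=g(x)\mathbf 1_{\{x>r\}},& x\notin(\ell,r].\end{cases}$$ -/

import Mathlib

open MeasureTheory Set
open scoped NNReal ENNReal Topology

namespace DrawdownCTMC

/-- `G` is a transition rate matrix on the finite state space `S ⊆ ℝ`: nonnegative off-diagonal
entries, and `G(x,x) = -∑_{y ≠ x} G(x,y)`. -/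
structure IsRateMatrix {S : Finset ℝ} (G : Matrix S S ℝ) : Prop where
  offDiag_nonneg : ∀ x y, x ≠ y → 0 ≤ G x y
  diag_eq : ∀ x, G x x = -∑ y ∈ Finset.univ.erase x, G x y

/-- `Y` is a continuous-time Markov chain on `S` with transition rate matrix `G`, where `P x` is
the probability law under which the chain starts at `x`: the paths are càdlàg and the
finite-dimensional distributions are those of the Markov transition function `exp (t G)`, i.e.
`P_{x₀}(Y_{t₀} = x₀, …, Y_{tₙ} = xₙ) = ∏ᵢ exp((t_{i+1} - t_i) G)(x_i, x_{i+1})`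
for `0 = t₀ ≤ t₁ ≤ … ≤ tₙ`. -/
structure IsCTMC {S : Finset ℝ} {Ω : Type*} [MeasurableSpace Ω] (G : Matrix S S ℝ)
    (P : S → Measure Ω) (Y : ℝ≥0 → Ω → S) : Prop where
  isRateMatrix : IsRateMatrix G
  isProbabilityMeasure : ∀ x, IsProbabilityMeasure (P x)
  measurable : ∀ t, Measurable (Y t)
  rightContinuous : ∀ ω t, ContinuousWithinAt (fun s => Y s ω) (Ici t) t
  leftLimits : ∀ ω t, ∃ z : S, Filter.Tendsto (fun s => Y s ω) (𝓝[<] t) (𝓝 z)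
  finiteDimensional : ∀ (n : ℕ) (t : Fin (n + 1) → ℝ≥0) (x : Fin (n + 1) → S),
    Monotone t → t 0 = 0 →
      (P (x 0)).real {ω | ∀ i, Y (t i) ω = x i} =
        ∏ i : Fin n, NormedSpace.exp (((t i.succ : ℝ) - (t i.castSucc : ℝ)) • G)
          (x i.castSucc) (x i.succ)

section Functionals

variable {S : Finset ℝ} {Ω : Type*}

open Classical in
/-- The running maximum at time `t`, when its value at time `0` is prescribed to be `y`:
the largest element of `{y} ∪ {Y_u : 0 ≤ u ≤ t}`. -/
noncomputable def runMax (Y : ℝ≥0 → Ω → S) (y : S) (t : ℝ≥0) (ω : Ω) : S :=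
  (insert y (Finset.univ.filter fun z : S => ∃ u ≤ t, Y u ω = z)).max'
    (Finset.insert_nonempty _ _)

/-- First passage time `T_A = inf {t > 0 : Y_t ∉ A}`, with value `∞` if there is no such `t`. -/
noncomputable def passageTime (Y : ℝ≥0 → Ω → S) (A : Set ℝ) (ω : Ω) : ℝ≥0∞ :=
  sInf ((fun t : ℝ≥0 => (t : ℝ≥0∞)) '' {t | 0 < t ∧ (Y t ω : ℝ) ∉ A})

/-- `T_r⁺ = T_{(-∞, r]}`. -/
noncomputable def upTime (Y : ℝ≥0 → Ω → S) (r : ℝ) : Ω → ℝ≥0∞ := passageTime Y (Iic r)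

/-- `T_ℓ⁻ = T_{(ℓ, ∞)}`. -/
noncomputable def downTime (Y : ℝ≥0 → Ω → S) (l : ℝ) : Ω → ℝ≥0∞ := passageTime Y (Ioi l)

/-- The drawdown time `τ_a = inf {t ≥ 0 : Ȳ_t - Y_t ≥ a}`, where `Ȳ₀ = y`. -/
noncomputable def drawdownTime (Y : ℝ≥0 → Ω → S) (y : S) (a : ℝ) (ω : Ω) : ℝ≥0∞ :=
  sInf ((fun t : ℝ≥0 => (t : ℝ≥0∞)) '' {t | a ≤ (runMax Y y t ω : ℝ) - (Y t ω : ℝ)})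

open Classical in
/-- The random variable `exp(-∫₀^{T_A} k(Y_s) ds) 1{T_A < ∞} f(Y_{T_A})`. -/
noncomputable def passageVar (Y : ℝ≥0 → Ω → S) (A : Set ℝ) (k : S → ℂ) (f : S → ℝ)
    (ω : Ω) : ℂ :=
  if passageTime Y A ω < ∞ then
    Complex.exp (-∫ s in (0 : ℝ)..(passageTime Y A ω).toReal, k (Y s.toNNReal ω)) *
      (f (Y (passageTime Y A ω).toNNReal ω) : ℂ)
  else 0

open Classical in
/-- The random variable `exp(-∫₀^{τ_a} k(Y_s, Ȳ_s) ds) 1{τ_a < ∞} f(Y_{τ_a})`, with `Ȳ₀ = y`. -/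
noncomputable def drawdownVar (Y : ℝ≥0 → Ω → S) (y : S) (a : ℝ) (k : S → S → ℂ) (f : S → ℝ)
    (ω : Ω) : ℂ :=
  if drawdownTime Y y a ω < ∞ then
    Complex.exp (-∫ s in (0 : ℝ)..(drawdownTime Y y a ω).toReal,
        k (Y s.toNNReal ω) (runMax Y y s.toNNReal ω)) *
      (f (Y (drawdownTime Y y a ω).toNNReal ω) : ℂ)
  else 0

open Classical in
/-- The random variable `exp(-∫₀^{T_r⁺} k(Y_s, Ȳ_s) ds) 1{T_ℓ⁻ > T_r⁺} g(Y_{T_r⁺})`,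
with `Ȳ₀ = y`. -/
noncomputable def upcrossVar (Y : ℝ≥0 → Ω → S) (y : S) (l r : ℝ) (k : S → S → ℂ) (g : S → ℝ)
    (ω : Ω) : ℂ :=
  if upTime Y r ω < downTime Y l ω then
    Complex.exp (-∫ s in (0 : ℝ)..(upTime Y r ω).toReal,
        k (Y s.toNNReal ω) (runMax Y y s.toNNReal ω)) *
      (g (Y (upTime Y r ω).toNNReal ω) : ℂ)
  else 0

variable [MeasurableSpace Ω]

/-- `P_A(k, x; f) = E[exp(-∫₀^{T_A} k(Y_s) ds) 1{T_A < ∞} f(Y_{T_A}) | Y₀ = x]`. -/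
noncomputable def passageP (P : S → Measure Ω) (Y : ℝ≥0 → Ω → S) (A : Set ℝ) (k : S → ℂ)
    (x : S) (f : S → ℝ) : ℂ :=
  ∫ ω, passageVar Y A k f ω ∂(P x)

/-- `C(k, x) = E[exp(-∫₀^{τ_a} k(Y_s, Ȳ_s) ds) 1{τ_a < ∞} f(Y_{τ_a}) | Y₀ = x, Ȳ₀ = x]`. -/
noncomputable def drawdownC (P : S → Measure Ω) (Y : ℝ≥0 → Ω → S) (a : ℝ) (f : S → ℝ)
    (k : S → S → ℂ) (x : S) : ℂ :=
  ∫ ω, drawdownVar Y x a k f ω ∂(P x)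

/-- `S_{(ℓ, r]}(k, x, y; g)
  = E[exp(-∫₀^{T_r⁺} k(Y_s, Ȳ_s) ds) 1{T_ℓ⁻ > T_r⁺} g(Y_{T_r⁺}) | Y₀ = x, Ȳ₀ = y]`. -/
noncomputable def upcrossS (P : S → Measure Ω) (Y : ℝ≥0 → Ω → S) (l r : ℝ) (k : S → S → ℂ)
    (x y : S) (g : S → ℝ) : ℂ :=
  ∫ ω, upcrossVar Y y l r k g ω ∂(P x)

end Functionals

end DrawdownCTMC

open DrawdownCTMC

/-!
All three functionals are discounted payoffs at the first exit of the pair `(Y, Ȳ)` from a set of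
pairs. The observations of `Y` at the times `0, h, 2h, …` satisfy an exact one-step recursion, which
only involves the finite-dimensional distributions; dividing it by `h` and letting `h → 0` gives the
equation `G u = κ u` for the expected payoff `u` inside the set. For `Re k > 0` this equation has a
unique solution with given values outside the strip `(x - a, x]`, by diagonal dominance of `κ - G`,
and both sides of the linear system for `C` are such solutions; this replaces the strong Markov
property. The case `Re k ≥ 0` follows by applying this to `k + δ` and letting `δ → 0`.
-/

namespace DrawdownCTMC

open Filter

section ExitPayoff

variable {X : Type*} {D : Set X} {κ g : X → ℂ} {h B : ℝ}

open Classical in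
/-- The discrete counterpart of `exitPayoff` with time step `h`: the value `g (w J)` at the first
exit index `J` of the sequence `w` from `D`, discounted at rate `κ`, and `0` if `w` stays in `D`.
The discount over the `i`-th step is evaluated at its right end point `w (i + 1)`. -/
noncomputable def seqExitPayoff (h : ℝ) (D : Set X) (κ g : X → ℂ) (w : ℕ → X) : ℂ :=
  if H : ∃ j, w j ∉ D then
    Complex.exp (-(h * ∑ i ∈ Finset.range (Nat.find H), κ (w (i + 1)))) * g (w (Nat.find H))
  else 0

lemma seqExitPayoff_of_isLeast {w : ℕ → X} {J : ℕ} (hJ : IsLeast {j | w j ∉ D} J) :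
    seqExitPayoff h D κ g w =
      Complex.exp (-(h * ∑ i ∈ Finset.range J, κ (w (i + 1)))) * g (w J) := by
  classical
  have H : ∃ j, w j ∉ D := ⟨J, hJ.1⟩
  obtain rfl : J = Nat.find H := hJ.unique (Nat.isLeast_find H)
  exact dif_pos H

lemma seqExitPayoff_of_forall_mem {w : ℕ → X} (hw : ∀ j, w j ∈ D) :
    seqExitPayoff h D κ g w = 0 :=
  dif_neg (by simpa using hw)

lemma seqExitPayoff_of_zero_mem {w : ℕ → X} (h0 : w 0 ∈ D) :
    seqExitPayoff h D κ g w =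
      Complex.exp (-(h * κ (w 1))) * seqExitPayoff h D κ g (fun j => w (j + 1)) := by
  classical
  by_cases H : ∃ j, w (j + 1) ∉ D
  · have hleast := Nat.isLeast_find H
    have hleast' : IsLeast {j | w j ∉ D} (Nat.find H + 1) := by
      refine ⟨hleast.1, fun j hj => ?_⟩
      cases j with
      | zero => exact absurd h0 hj
      | succ j => exact Nat.succ_le_succ (hleast.2 hj)
    rw [seqExitPayoff_of_isLeast hleast', seqExitPayoff_of_isLeast hleast, ← mul_assoc,
      ← Complex.exp_add, Finset.sum_range_succ']
    ring_nf
  · have hin : ∀ j, w (j + 1) ∈ D := by simpa using H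
    rw [seqExitPayoff_of_forall_mem hin, mul_zero]
    exact seqExitPayoff_of_forall_mem fun j => by
      cases j with
      | zero => exact h0
      | succ j => exact hin j

lemma norm_seqExitPayoff_le (hh : 0 ≤ h) (hκ : ∀ x, 0 ≤ (κ x).re) (hg : ∀ x, ‖g x‖ ≤ B)
    (w : ℕ → X) : ‖seqExitPayoff h D κ g w‖ ≤ B := by
  classical
  unfold seqExitPayoff
  split_ifs with H
  · have hexp : ‖Complex.exp (-(h * ∑ i ∈ Finset.range (Nat.find H), κ (w (i + 1))))‖ ≤ 1 := by
      rw [Complex.norm_exp, Real.exp_le_one_iff]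
      simpa using mul_nonneg hh (Finset.sum_nonneg fun i _ => hκ (w (i + 1)))
    simpa using mul_le_mul hexp (hg _) (norm_nonneg _) zero_le_one
  · simpa using (norm_nonneg _).trans (hg (w 0))

lemma measurable_seqExitPayoff [MeasurableSpace X] [DiscreteMeasurableSpace X] :
    Measurable (seqExitPayoff h D κ g) := by
  classical
  have hcoord (j : ℕ) : Measurable fun w : ℕ → X => w j := measurable_pi_apply j
  have hmem (j : ℕ) : MeasurableSet {w : ℕ → X | w j ∉ D} :=
    hcoord j (MeasurableSet.of_discrete (s := Dᶜ))
  have happly (φ : X → ℂ) (j : ℕ) : Measurable fun w : ℕ → X => φ (w j) :=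
    Measurable.of_discrete.comp (hcoord j)
  have hexit : MeasurableSet {w : ℕ → X | ∃ j, w j ∉ D} := by
    simpa only [ofPred_exists] using MeasurableSet.iUnion hmem
  have hpayoff (n : ℕ) : Measurable fun w : ℕ → X =>
      Complex.exp (-(h * ∑ i ∈ Finset.range n, κ (w (i + 1)))) * g (w n) := by
    have := happly g n
    have := fun i => happly κ (i + 1)
    fun_prop
  exact Measurable.dite (s := {w | ∃ j, w j ∉ D})
    (Measurable.find (fun n => (hpayoff n).comp measurable_subtype_coe)
      (fun n => measurable_subtype_coe (hmem n)) fun w => w.2) measurable_const hexit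

/-- The first time at which the path `w` is outside of `D`, and `∞` if there is none. -/
noncomputable def exitTime (D : Set X) (w : ℝ≥0 → X) : ℝ≥0∞ :=
  sInf ((fun t : ℝ≥0 => (t : ℝ≥0∞)) '' {t | w t ∉ D})

/-- The value of `g` at the first exit of the path `w` from `D`, discounted at rate `κ` along the
path, and `0` if `w` stays in `D`. All functionals of the theorem are of this form, for `w` the
path of the chain paired with its running maximum. -/
noncomputable def exitPayoff (D : Set X) (κ g : X → ℂ) (w : ℝ≥0 → X) : ℂ :=
  if exitTime D w < ∞ then
    Complex.exp (-∫ s in (0 : ℝ)..(exitTime D w).toReal, κ (w s.toNNReal)) *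
      g (w (exitTime D w).toNNReal)
  else 0

variable {w : ℝ≥0 → X} {T : ℝ≥0}

lemma exitTime_of_isLeast (hT : IsLeast {t | w t ∉ D} T) : exitTime D w = T :=
  (ENNReal.coe_mono.map_isLeast hT).csInf_eq

lemma exitTime_of_forall_mem (hw : ∀ t, w t ∈ D) : exitTime D w = ∞ := by
  simp [exitTime, hw]

lemma exitTime_mono {E : Set X} (hDE : D ⊆ E) : exitTime D w ≤ exitTime E w :=
  sInf_le_sInf (image_mono fun _ ht hmem => ht (hDE hmem))

lemma exitPayoff_of_isLeast (hT : IsLeast {t | w t ∉ D} T) :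
    exitPayoff D κ g w =
      Complex.exp (-∫ s in (0 : ℝ)..T, κ (w s.toNNReal)) * g (w T) := by
  simp [exitPayoff, exitTime_of_isLeast hT]

lemma exitPayoff_of_forall_mem (hw : ∀ t, w t ∈ D) : exitPayoff D κ g w = 0 := by
  simp [exitPayoff, exitTime_of_forall_mem hw]

lemma exitPayoff_of_zero_notMem (h0 : w 0 ∉ D) : exitPayoff D κ g w = g (w 0) := by
  rw [exitPayoff_of_isLeast (T := 0) ⟨h0, fun _ _ => zero_le⟩]
  simp

lemma re_intervalIntegral_nonneg {φ : ℝ → ℂ} {b : ℝ} (hb : 0 ≤ b) (hφ : ∀ s, 0 ≤ (φ s).re) :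
    0 ≤ (∫ s in (0 : ℝ)..b, φ s).re := by
  rw [intervalIntegral.integral_of_le hb]
  by_cases hint : IntegrableOn φ (Ioc 0 b)
  · exact (integral_nonneg hφ).trans_eq (integral_re hint)
  · simp [integral_undef hint]

lemma norm_exitPayoff_le (hκ : ∀ x, 0 ≤ (κ x).re) (hg : ∀ x, ‖g x‖ ≤ B) :
    ‖exitPayoff D κ g w‖ ≤ B := by
  unfold exitPayoff
  split_ifs
  · have hexp :
        ‖Complex.exp (-∫ s in (0 : ℝ)..(exitTime D w).toReal, κ (w s.toNNReal))‖ ≤ 1 := by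
      rw [Complex.norm_exp, Real.exp_le_one_iff, Complex.neg_re, neg_nonpos]
      exact re_intervalIntegral_nonneg ENNReal.toReal_nonneg fun s => hκ _
    simpa using mul_le_mul hexp (hg _) (norm_nonneg _) zero_le_one
  · simpa using (norm_nonneg _).trans (hg (w 0))

lemma tendsto_exitPayoff_add_const
    (hκ : ∀ b, IntervalIntegrable (fun s : ℝ => κ (w s.toNNReal)) volume 0 b) :
    Tendsto (fun δ : ℝ => exitPayoff D (fun x => κ x + δ) g w) (𝓝 0)
      (𝓝 (exitPayoff D κ g w)) := by
  unfold exitPayoff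
  split_ifs
  · have hintegral (δ b : ℝ) : ∫ s in (0 : ℝ)..b, (κ (w s.toNNReal) + δ) =
        (∫ s in (0 : ℝ)..b, κ (w s.toNNReal)) + b * δ := by
      rw [intervalIntegral.integral_add (hκ b) intervalIntegrable_const]
      simp
    simp only [hintegral]
    exact Continuous.tendsto' (by fun_prop) _ _ (by simp)
  · exact tendsto_const_nhds

end ExitPayoff

section Grid

variable {φ : ℕ → ℂ} {B : ℝ} {h : ℝ≥0}

lemma tendsto_natCeil_div_mul (s : ℝ≥0) :
    Tendsto (fun h : ℝ≥0 => (⌈s / h⌉₊ : ℝ≥0) * h) (𝓝[>] 0) (𝓝[≥] s) := by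
  have hle : ∀ᶠ h : ℝ≥0 in 𝓝[>] 0, s ≤ (⌈s / h⌉₊ : ℝ≥0) * h := by
    filter_upwards [self_mem_nhdsWithin] with h hh
    exact (div_le_iff₀ hh).1 (Nat.le_ceil _)
  have hge : ∀ᶠ h : ℝ≥0 in 𝓝[>] 0, (⌈s / h⌉₊ : ℝ≥0) * h ≤ s + h := by
    filter_upwards [self_mem_nhdsWithin] with h hh
    calc (⌈s / h⌉₊ : ℝ≥0) * h ≤ (s / h + 1) * h := by
          gcongr
          exact (Nat.ceil_lt_add_one zero_le).le
      _ = s + h := by rw [add_mul, div_mul_cancel₀ _ hh.ne', one_mul]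
  have hadd : Tendsto (fun h : ℝ≥0 => s + h) (𝓝[>] 0) (𝓝 s) :=
    (Continuous.tendsto' (by fun_prop) _ _ (add_zero s)).mono_left nhdsWithin_le_nhds
  exact tendsto_nhdsWithin_iff.2
    ⟨tendsto_of_tendsto_of_tendsto_of_le_of_le' tendsto_const_nhds hadd hle hge, hle⟩

lemma measurable_comp_natCeil_div (φ : ℕ → ℂ) (h : ℝ≥0) :
    Measurable fun s : ℝ => φ ⌈s.toNNReal / h⌉₊ :=
  Measurable.of_discrete.comp (Nat.measurable_ceil.comp (measurable_real_toNNReal.div_const h))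

lemma intervalIntegrable_comp_natCeil_div (hφ : ∀ i, ‖φ i‖ ≤ B) (h : ℝ≥0) (a b : ℝ) :
    IntervalIntegrable (fun s : ℝ => φ ⌈s.toNNReal / h⌉₊) volume a b :=
  (intervalIntegrable_const (c := B)).mono_fun
    (measurable_comp_natCeil_div φ h).aestronglyMeasurable
    (.of_forall fun _ => (hφ _).trans (le_abs_self B))

lemma natCeil_toNNReal_div_eq (hh : 0 < h) {i : ℕ} {s : ℝ}
    (hs : s ∈ Ioc (i * h : ℝ) ((i + 1 : ℕ) * h)) : ⌈s.toNNReal / h⌉₊ = i + 1 := by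
  have hcoe : (s.toNNReal : ℝ) = s :=
    Real.coe_toNNReal s (le_trans (by positivity) hs.1.le)
  rw [Nat.ceil_eq_iff i.succ_ne_zero, lt_div_iff₀ hh, div_le_iff₀ hh, ← NNReal.coe_lt_coe,
    ← NNReal.coe_le_coe]
  simpa [hcoe] using hs

lemma integral_comp_natCeil_div (hφ : ∀ i, ‖φ i‖ ≤ B) (hh : 0 < h) (J : ℕ) :
    ∫ s in (0 : ℝ)..J * h, φ ⌈s.toNNReal / h⌉₊ = h * ∑ i ∈ Finset.range J, φ (i + 1) := by
  have hcell (i : ℕ) :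
      ∫ s in (i * h : ℝ)..(i + 1 : ℕ) * h, φ ⌈s.toNNReal / h⌉₊ = h * φ (i + 1) := by
    have hle : (i * h : ℝ) ≤ (i + 1 : ℕ) * h := by gcongr; simp
    calc ∫ s in (i * h : ℝ)..(i + 1 : ℕ) * h, φ ⌈s.toNNReal / h⌉₊
        = ∫ _ in (i * h : ℝ)..(i + 1 : ℕ) * h, φ (i + 1) := by
          refine intervalIntegral.integral_congr_ae (.of_forall fun s hs => ?_)
          rw [uIoc_of_le hle] at hs
          rw [natCeil_toNNReal_div_eq hh hs]
      _ = h * φ (i + 1) := by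
          rw [intervalIntegral.integral_const, Complex.real_smul]
          push_cast
          ring
  have hsum := intervalIntegral.sum_integral_adjacent_intervals (a := fun i : ℕ => (i * h : ℝ))
    (n := J) fun i _ => intervalIntegrable_comp_natCeil_div hφ h _ _
  simpa only [hcell, Nat.cast_zero, zero_mul, ← Finset.mul_sum] using hsum.symm

end Grid

section GridApprox

variable {X : Type*}

/-- Right-continuity for the discrete topology on `X`. -/
def RightLocallyConstant (w : ℝ≥0 → X) : Prop :=
  ∀ t, ∀ᶠ s in 𝓝[≥] t, w s = w t

lemma RightLocallyConstant.exists_isLeast {w : ℝ≥0 → X} (hw : RightLocallyConstant w)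
    {D : Set X} (hex : ∃ t, w t ∉ D) : ∃ T, IsLeast {t | w t ∉ D} T := by
  refine ⟨sInf {t | w t ∉ D}, ?_, fun t ht => csInf_le (OrderBot.bddBelow _) ht⟩
  by_contra hin
  obtain ⟨u, hu, hconst⟩ := mem_nhdsGE_iff_exists_Ico_subset.1 (hw (sInf {t | w t ∉ D}))
  obtain ⟨t, ht, htu⟩ := exists_lt_of_csInf_lt hex hu
  have heq : w t = w (sInf {t | w t ∉ D}) := hconst ⟨csInf_le (OrderBot.bddBelow _) ht, htu⟩
  exact hin fun hmem => ht (heq ▸ hmem)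

lemma RightLocallyConstant.lt_exitTime_iff {w : ℝ≥0 → X} (hw : RightLocallyConstant w)
    {D : Set X} {T : ℝ≥0} : T < exitTime D w ↔ ∀ t ≤ T, w t ∈ D := by
  by_cases hex : ∃ t, w t ∉ D
  · obtain ⟨T₀, hT₀⟩ := hw.exists_isLeast hex
    rw [exitTime_of_isLeast hT₀, ENNReal.coe_lt_coe]
    refine ⟨fun hT t ht => ?_, fun hT => lt_of_not_ge fun hle => hT₀.1 (hT T₀ hle)⟩
    by_contra hout
    exact (hT₀.2 hout).not_gt (ht.trans_lt hT)
  · have hin : ∀ t, w t ∈ D := by simpa using hex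
    simp [exitTime_of_forall_mem hin, hin]

/-- The sequences `v h`, read as paths that are constant on the time steps of length `h`, converge
to `w` as `h` decreases to `0` (for the discrete topology on `X`). -/
def IsGridApprox (v : ℝ≥0 → ℕ → X) (w : ℝ≥0 → X) : Prop :=
  ∀ s, ∀ᶠ h in 𝓝[>] 0, v h ⌈s / h⌉₊ = w s

lemma RightLocallyConstant.isGridApprox {w : ℝ≥0 → X} (hw : RightLocallyConstant w) :
    IsGridApprox (fun h j => w (j * h)) w :=
  fun s => (tendsto_natCeil_div_mul s).eventually (hw s)

namespace IsGridApprox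

variable {v : ℝ≥0 → ℕ → X} {w : ℝ≥0 → X}

lemma tendsto_comp (hv : IsGridApprox v w) (κ : X → ℂ) (s : ℝ≥0) :
    Tendsto (fun h => κ (v h ⌈s / h⌉₊)) (𝓝[>] 0) (𝓝 (κ (w s))) :=
  tendsto_const_nhds.congr' ((hv s).mono fun _ hh => congrArg κ hh.symm)

lemma aestronglyMeasurable_comp (hv : IsGridApprox v w) (κ : X → ℂ) (μ : Measure ℝ) :
    AEStronglyMeasurable (fun s : ℝ => κ (w s.toNNReal)) μ :=
  aestronglyMeasurable_of_tendsto_ae (𝓝[>] (0 : ℝ≥0))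
    (fun h => (measurable_comp_natCeil_div (fun j => κ (v h j)) h).aestronglyMeasurable)
    (.of_forall fun s => hv.tendsto_comp κ s.toNNReal)

variable [Finite X]

lemma intervalIntegrable_comp (hv : IsGridApprox v w) (κ : X → ℂ) (a b : ℝ) :
    IntervalIntegrable (fun s : ℝ => κ (w s.toNNReal)) volume a b := by
  cases nonempty_fintype X
  exact (intervalIntegrable_const (c := ‖κ‖)).mono_fun (hv.aestronglyMeasurable_comp κ _)
    (.of_forall fun _ => by simpa using norm_le_pi_norm κ _)

lemma tendsto_riemannSum (hv : IsGridApprox v w) (κ : X → ℂ) (T : ℝ≥0) :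
    Tendsto (fun h : ℝ≥0 => (h : ℂ) * ∑ i ∈ Finset.range ⌈T / h⌉₊, κ (v h (i + 1))) (𝓝[>] 0)
      (𝓝 (∫ s in (0 : ℝ)..T, κ (w s.toNNReal))) := by
  cases nonempty_fintype X
  have hbound (h : ℝ≥0) (j : ℕ) : ‖κ (v h j)‖ ≤ ‖κ‖ := norm_le_pi_norm κ _
  have hmain : Tendsto (fun h : ℝ≥0 => ∫ s in (0 : ℝ)..T, κ (v h ⌈s.toNNReal / h⌉₊)) (𝓝[>] 0)
      (𝓝 (∫ s in (0 : ℝ)..T, κ (w s.toNNReal))) :=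
    intervalIntegral.tendsto_integral_filter_of_dominated_convergence (fun _ => ‖κ‖)
      (.of_forall fun h =>
        (measurable_comp_natCeil_div (fun j => κ (v h j)) h).aestronglyMeasurable)
      (.of_forall fun h => .of_forall fun s _ => hbound _ _)
      intervalIntegrable_const
      (.of_forall fun s _ => hv.tendsto_comp κ s.toNNReal)
  have htail : Tendsto (fun h : ℝ≥0 =>
      ∫ s in (T : ℝ)..⌈T / h⌉₊ * h, κ (v h ⌈s.toNNReal / h⌉₊)) (𝓝[>] 0) (𝓝 0) := by
    have hT : Tendsto (fun h : ℝ≥0 => ‖κ‖ * |(⌈T / h⌉₊ : ℝ) * h - T|) (𝓝[>] 0) (𝓝 0) := by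
      have := (tendsto_natCeil_div_mul T).mono_right nhdsWithin_le_nhds
      simpa using ((NNReal.tendsto_coe.2 this).sub_const (T : ℝ)).abs.const_mul ‖κ‖
    exact squeeze_zero_norm (fun h =>
      intervalIntegral.norm_integral_le_of_norm_le_const fun s _ => hbound _ _) hT
  have hadd := hmain.add htail
  rw [add_zero] at hadd
  refine hadd.congr' ?_
  filter_upwards [self_mem_nhdsWithin] with h hh
  rw [intervalIntegral.integral_add_adjacent_intervals
      (intervalIntegrable_comp_natCeil_div (hbound h) h _ _)
      (intervalIntegrable_comp_natCeil_div (hbound h) h _ _),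
    integral_comp_natCeil_div (hbound h) hh]

lemma tendsto_seqExitPayoff (hv : IsGridApprox v w) (hw : RightLocallyConstant w) {D : Set X}
    (hD : ∀ (h : ℝ≥0) (j : ℕ), w (j * h) ∈ D → v h j ∈ D) (κ g : X → ℂ) :
    Tendsto (fun h : ℝ≥0 => seqExitPayoff h D κ g (v h)) (𝓝[>] 0)
      (𝓝 (exitPayoff D κ g w)) := by
  by_cases hex : ∃ t, w t ∉ D
  · obtain ⟨T, hT⟩ := hw.exists_isLeast hex
    rw [exitPayoff_of_isLeast hT]
    refine ((hv.tendsto_riemannSum κ T).neg.cexp.mul_const (g (w T))).congr' ?_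
    filter_upwards [self_mem_nhdsWithin, hv T] with h hh hvT
    have hleast : IsLeast {j | v h j ∉ D} ⌈T / h⌉₊ := by
      refine ⟨?_, fun j hj => Nat.ceil_le.2 ((div_le_iff₀ hh).2 ?_)⟩
      · rw [mem_ofPred_eq, hvT]
        exact hT.1
      · exact hT.2 fun hmem => hj (hD h j hmem)
    rw [seqExitPayoff_of_isLeast hleast, hvT]
  · have hin : ∀ t, w t ∈ D := by simpa using hex
    rw [exitPayoff_of_forall_mem hin]
    refine tendsto_const_nhds.congr fun h => ?_
    rw [seqExitPayoff_of_forall_mem fun j => hD h j (hin _)]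

end IsGridApprox

end GridApprox

/-- The sequence `z` paired with its running maximum, where `y` is included in the maximum. -/
def withMax {α : Type*} [SemilatticeSup α] (y : α) (z : ℕ → α) (j : ℕ) : α × α :=
  (z j, y ⊔ partialSups z j)

lemma withMax_succ {α : Type*} [SemilatticeSup α] {y : α} {z : ℕ → α} (h0 : z 0 ≤ y) (j : ℕ) :
    withMax y z (j + 1) = withMax y (fun i => z (i + 1)) j := by
  have hsup : partialSups z (j + 1) = z 0 ⊔ partialSups (fun i => z (i + 1)) j :=
    partialSups_succ' z j
  rw [withMax, withMax, hsup, ← sup_assoc, sup_eq_left.2 h0]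

lemma measurable_withMax {α : Type*} [SemilatticeSup α] [MeasurableSpace α] [MeasurableSup₂ α]
    (y : α) : Measurable (withMax y) := by
  have hsup (j : ℕ) : Measurable fun z : ℕ → α => partialSups z j := by
    induction j with
    | zero => simpa using measurable_pi_apply 0
    | succ j ih =>
      simp only [partialSups_add_one]
      exact ih.sup (measurable_pi_apply (j + 1))
  exact measurable_pi_lambda _ fun j =>
    (measurable_pi_apply j).prodMk (measurable_const.sup (hsup j))

section RunMax

variable {S : Finset ℝ} {Ω : Type*} {Y : ℝ≥0 → Ω → S} {y b : S} {s t : ℝ≥0} {ω : Ω}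

lemma runMax_le_iff : runMax Y y t ω ≤ b ↔ y ≤ b ∧ ∀ u ≤ t, Y u ω ≤ b := by
  simp [runMax, Finset.max'_le_iff]

lemma le_runMax_start : y ≤ runMax Y y t ω :=
  (runMax_le_iff.1 le_rfl).1

lemma le_runMax (hst : s ≤ t) : Y s ω ≤ runMax Y y t ω :=
  (runMax_le_iff.1 le_rfl).2 s hst

lemma runMax_mono (hst : s ≤ t) : runMax Y y s ω ≤ runMax Y y t ω :=
  runMax_le_iff.2 ⟨le_runMax_start, fun _ hu => le_runMax (hu.trans hst)⟩

lemma runMax_eq_or : runMax Y y t ω = y ∨ ∃ u ≤ t, Y u ω = runMax Y y t ω := by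
  classical
  simpa [runMax] using Finset.max'_mem
    (insert y (Finset.univ.filter fun z : S => ∃ u ≤ t, Y u ω = z)) (Finset.insert_nonempty _ _)

lemma runMax_zero : runMax Y y 0 ω = y ⊔ Y 0 ω :=
  eq_of_forall_ge_iff fun b => by simp [runMax_le_iff]

lemma runMax_sup_zero : runMax Y (y ⊔ Y 0 ω) t ω = runMax Y y t ω :=
  eq_of_forall_ge_iff fun b => by
    simpa [runMax_le_iff, and_assoc] using fun _ h => h 0 zero_le

/-- The observations of `Y` at the times `0, h, 2h, …`. -/
def skeleton (Y : ℝ≥0 → Ω → S) (h : ℝ≥0) (ω : Ω) (j : ℕ) : S :=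
  Y (j * h) ω

lemma sup_partialSups_skeleton_le_runMax (h : ℝ≥0) (j : ℕ) :
    y ⊔ partialSups (skeleton Y h ω) j ≤ runMax Y y (j * h) ω :=
  sup_le le_runMax_start (partialSups_le _ _ _ fun i hi => le_runMax (by gcongr))

/-- The path of `ω` paired with its running maximum, that is `t ↦ (Y_t, Ȳ_t)`. -/
noncomputable def pathWithMax (Y : ℝ≥0 → Ω → S) (y : S) (ω : Ω) (t : ℝ≥0) : S × S :=
  (Y t ω, runMax Y y t ω)

lemma pathWithMax_sup_zero : pathWithMax Y (y ⊔ Y 0 ω) ω = pathWithMax Y y ω := by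
  ext1 t
  rw [pathWithMax, pathWithMax, runMax_sup_zero]

lemma rightLocallyConstant_pathWithMax (hω : RightLocallyConstant fun t => Y t ω) (y : S) :
    RightLocallyConstant (pathWithMax Y y ω) := by
  intro t
  obtain ⟨u, htu, hu⟩ := mem_nhdsGE_iff_exists_Ico_subset.1 (hω t)
  filter_upwards [Ico_mem_nhdsGE htu] with s hs
  have hmax : runMax Y y s ω ≤ runMax Y y t ω := by
    refine runMax_le_iff.2 ⟨le_runMax_start, fun v hv => ?_⟩
    rcases le_total v t with hvt | htv
    · exact le_runMax hvt
    · exact (hu ⟨htv, hv.trans_lt hs.2⟩ : Y v ω = Y t ω).trans_le (le_runMax le_rfl)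
  exact Prod.ext (hu hs) (hmax.antisymm (runMax_mono hs.1))

lemma isGridApprox_pathWithMax (hω : RightLocallyConstant fun t => Y t ω) (y : S) :
    IsGridApprox (fun h => withMax y (skeleton Y h ω)) (pathWithMax Y y ω) := by
  intro s
  have hge : ∀ᶠ h : ℝ≥0 in 𝓝[>] 0,
      runMax Y y s ω ≤ y ⊔ partialSups (skeleton Y h ω) ⌈s / h⌉₊ := by
    rcases runMax_eq_or (Y := Y) (y := y) (t := s) (ω := ω) with hy | ⟨u, hu, hmax⟩
    · exact .of_forall fun _ => hy.trans_le le_sup_left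
    · filter_upwards [hω.isGridApprox u] with h hh
      rw [← hmax, ← hh]
      exact (le_partialSups_of_le (skeleton Y h ω) (by gcongr)).trans le_sup_right
  filter_upwards [hge, (rightLocallyConstant_pathWithMax hω y).isGridApprox s] with h hh hgrid
  obtain ⟨hpos, hmax⟩ := Prod.ext_iff.1 hgrid
  exact Prod.ext hpos (((sup_partialSups_skeleton_le_runMax h _).trans_eq hmax).antisymm hh)

lemma tendsto_seqExitPayoff_withMax (hω : RightLocallyConstant fun t => Y t ω) (y : S)
    {D : Set (S × S)} (hD : ∀ x, IsLowerSet {m | (x, m) ∈ D}) (κ g : S × S → ℂ) :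
    Tendsto (fun h : ℝ≥0 => seqExitPayoff h D κ g (withMax y (skeleton Y h ω))) (𝓝[>] 0)
      (𝓝 (exitPayoff D κ g (pathWithMax Y y ω))) :=
  (isGridApprox_pathWithMax hω y).tendsto_seqExitPayoff (rightLocallyConstant_pathWithMax hω y)
    (fun h j hmem => hD (Y (j * h) ω) (sup_partialSups_skeleton_le_runMax h j) hmem) κ g

end RunMax

lemma ext_of_forall_eq_on_le {X : Type*} [Countable X] [MeasurableSpace X]
    [MeasurableSingletonClass X] {μ ν : Measure (ℕ → X)} [IsFiniteMeasure ν]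
    (h : ∀ (n : ℕ) (p : ℕ → X), μ {w | ∀ i ≤ n, w i = p i} = ν {w | ∀ i ≤ n, w i = p i}) :
    μ = ν := by
  have hproj : IsProjectiveMeasureFamily fun I : Finset ℕ => ν.map I.restrict := fun I J hJI => by
    rw [Measure.map_map (Finset.measurable_restrict₂ hJI) (Finset.measurable_restrict I)]
    rfl
  have hcyl (n : ℕ) (q : Finset.Iic n → X) :
      (Preorder.frestrictLe n : (ℕ → X) → Finset.Iic n → X) ⁻¹' {q} =
        {w | ∀ i ≤ n, w i = q ⟨min i n, by simp⟩} := by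
    ext w
    simp +contextual [funext_iff]
  refine IsProjectiveLimit.unique (P := fun I : Finset ℕ => ν.map I.restrict)
    ((isProjectiveLimit_nat_iff hproj μ).2 fun n => Measure.ext_of_singleton fun q => ?_)
    fun I => rfl
  have hmeas := Preorder.measurable_frestrictLe (X := fun _ => X) n
  change μ.map (Preorder.frestrictLe n) {q} = ν.map (Preorder.frestrictLe n) {q}
  rw [Measure.map_apply hmeas (measurableSet_singleton q),
    Measure.map_apply hmeas (measurableSet_singleton q), hcyl, h]

section Skeleton

variable {S : Finset ℝ} {Ω : Type*} [MeasurableSpace Ω] {G : Matrix S S ℝ}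
  {P : S → Measure Ω} {Y : ℝ≥0 → Ω → S}

namespace IsCTMC

lemma rightLocallyConstant (hY : IsCTMC G P Y) (ω : Ω) :
    RightLocallyConstant fun t => Y t ω := fun t => by
  simpa only [ContinuousWithinAt, nhds_discrete, Filter.tendsto_pure]
    using hY.rightContinuous ω t

lemma ae_eq_start (hY : IsCTMC G P Y) (x : S) : ∀ᵐ ω ∂(P x), Y 0 ω = x := by
  have := hY.isProbabilityMeasure x
  have hmeas : MeasurableSet {ω | Y 0 ω = x} := hY.measurable 0 (measurableSet_singleton x)
  refine (prob_compl_eq_zero_iff hmeas).2 ?_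
  simpa [measureReal_def, ENNReal.toReal_eq_one_iff]
    using hY.finiteDimensional 0 (fun _ => 0) (fun _ => x) monotone_const rfl

lemma ae_skeleton_zero (hY : IsCTMC G P Y) (h : ℝ≥0) (x : S) :
    ∀ᵐ ω ∂(P x), skeleton Y h ω 0 = x := by
  simpa only [skeleton, Nat.cast_zero, zero_mul] using hY.ae_eq_start x

lemma measurable_skeleton (hY : IsCTMC G P Y) (h : ℝ≥0) : Measurable (skeleton Y h) :=
  measurable_pi_lambda _ fun _ => hY.measurable _

lemma measure_skeleton_eq_on_le (hY : IsCTMC G P Y) (h : ℝ≥0) (x : S) (n : ℕ) (p : ℕ → S) :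
    P x {ω | ∀ i ≤ n, skeleton Y h ω i = p i} = ENNReal.ofReal (if p 0 = x then
      ∏ i ∈ Finset.range n, NormedSpace.exp ((h : ℝ) • G) (p i) (p (i + 1)) else 0) := by
  have := hY.isProbabilityMeasure x
  split_ifs with hx
  · subst hx
    have hset : {ω | ∀ i ≤ n, skeleton Y h ω i = p i} =
        {ω | ∀ i : Fin (n + 1), Y ((i : ℕ) * h) ω = p i} := by
      ext ω
      simp [skeleton, Fin.forall_iff]
    have hfd : (P (p 0)).real {ω | ∀ i : Fin (n + 1), Y ((i : ℕ) * h) ω = p i} = _ :=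
      hY.finiteDimensional n (fun i => (i : ℕ) * h) (fun i => p i)
        (fun i j hij => mul_le_mul_left (Nat.cast_le.2 hij) h) (by simp)
    rw [hset, ← ofReal_measureReal, hfd, Finset.prod_range]
    simp [add_mul]
  · rw [ENNReal.ofReal_zero]
    refine measure_eq_zero_iff_ae_notMem.2 ((hY.ae_skeleton_zero h x).mono fun ω h0 hω => hx ?_)
    exact (hω 0 (Nat.zero_le n)).symm.trans h0

lemma measure_skeleton_succ_eq_on_le (hY : IsCTMC G P Y) (h : ℝ≥0) (x : S) (n : ℕ) (p : ℕ → S) :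
    P x {ω | ∀ i ≤ n, skeleton Y h ω (i + 1) = p i} =
      ENNReal.ofReal (NormedSpace.exp ((h : ℝ) • G) x (p 0) *
        ∏ i ∈ Finset.range n, NormedSpace.exp ((h : ℝ) • G) (p i) (p (i + 1))) := by
  let q : ℕ → S := Nat.rec x fun i _ => p i
  have hq : P x {ω | ∀ i ≤ n, skeleton Y h ω (i + 1) = p i} =
      P x {ω | ∀ i ≤ n + 1, skeleton Y h ω i = q i} := by
    refine measure_congr ((hY.ae_skeleton_zero h x).mono fun ω h0 =>
      propext ⟨fun hω i hi => ?_, fun hω i hi => hω (i + 1) (Nat.succ_le_succ hi)⟩)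
    cases i with
    | zero => exact h0
    | succ i => exact hω i (Nat.succ_le_succ_iff.1 hi)
  rw [hq, hY.measure_skeleton_eq_on_le, if_pos (show q 0 = x from rfl),
    Finset.prod_range_succ', mul_comm]
  rfl

lemma transition_nonneg (hY : IsCTMC G P Y) (h : ℝ≥0) (x z : S) :
    0 ≤ NormedSpace.exp ((h : ℝ) • G) x z := by
  have hfd := hY.finiteDimensional 1 ![0, h] ![x, z] (by simp [Fin.monotone_iff_le_succ]) rfl
  have : NormedSpace.exp ((h : ℝ) • G) x z = (P x).real {ω | ∀ i, Y (![0, h] i) ω = ![x, z] i} := by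
    simpa using hfd.symm
  exact this ▸ measureReal_nonneg

lemma map_skeleton_succ (hY : IsCTMC G P Y) (h : ℝ≥0) (x : S) :
    (P x).map (fun ω j => skeleton Y h ω (j + 1)) =
      ∑ z, ENNReal.ofReal (NormedSpace.exp ((h : ℝ) • G) x z) • (P z).map (skeleton Y h) := by
  have := hY.isProbabilityMeasure
  have hshift : Measurable fun ω j => skeleton Y h ω (j + 1) :=
    measurable_pi_lambda _ fun _ => hY.measurable _
  have : IsFiniteMeasure ((P x).map fun ω j => skeleton Y h ω (j + 1)) := inferInstance
  refine (ext_of_forall_eq_on_le fun n p => ?_).symm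
  have hmeas : MeasurableSet {w : ℕ → S | ∀ i ≤ n, w i = p i} := by
    measurability
  rw [Measure.map_apply hshift hmeas, Measure.finsetSum_apply]
  simp only [Measure.smul_apply, Measure.map_apply (hY.measurable_skeleton h) hmeas,
    preimage_ofPred_eq, hY.measure_skeleton_eq_on_le, hY.measure_skeleton_succ_eq_on_le]
  rw [Finset.sum_eq_single (p 0) (fun z _ hz => by simp [hz.symm]) (by simp), if_pos rfl,
    smul_eq_mul, ENNReal.ofReal_mul (hY.transition_nonneg h x _)]

lemma integral_comp_skeleton_succ (hY : IsCTMC G P Y) (h : ℝ≥0) (x : S) {Φ : (ℕ → S) → ℂ}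
    (hΦ : Measurable Φ) {B : ℝ} (hB : ∀ w, ‖Φ w‖ ≤ B) :
    ∫ ω, Φ (fun j => skeleton Y h ω (j + 1)) ∂(P x) =
      ∑ z, (NormedSpace.exp ((h : ℝ) • G) x z : ℂ) * ∫ ω, Φ (skeleton Y h ω) ∂(P z) := by
  have := hY.isProbabilityMeasure
  have hshift : Measurable fun ω j => skeleton Y h ω (j + 1) :=
    measurable_pi_lambda _ fun _ => hY.measurable _
  rw [← integral_map hshift.aemeasurable hΦ.aestronglyMeasurable, hY.map_skeleton_succ,
    integral_finsetSum_measure fun z _ =>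
      (Integrable.of_bound hΦ.aestronglyMeasurable B (.of_forall hB)).smul_measure
        ENNReal.ofReal_ne_top]
  refine Finset.sum_congr rfl fun z _ => ?_
  rw [integral_smul_measure, ENNReal.toReal_ofReal (hY.transition_nonneg h x z),
    integral_map (hY.measurable_skeleton h).aemeasurable hΦ.aestronglyMeasurable,
    Complex.real_smul]

end IsCTMC

end Skeleton

open scoped Matrix.Norms.Operator in
lemma hasDerivAt_exp_smul_apply {n : Type*} [Fintype n] [DecidableEq n] (G : Matrix n n ℝ)
    (x z : n) : HasDerivAt (fun t : ℝ => NormedSpace.exp (t • G) x z) (G x z) 0 := by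
  have h := hasDerivAt_exp_smul_const (𝕂 := ℝ) G (0 : ℝ)
  rw [zero_smul, NormedSpace.exp_zero, one_mul] at h
  exact hasDerivAt_pi.1 (hasDerivAt_pi.1 h x) z

lemma hasDerivAt_exp_smul_apply_mul_cexp {n : Type*} [Fintype n] [DecidableEq n]
    (G : Matrix n n ℝ) (x z : n) (c : ℂ) :
    HasDerivAt (fun t : ℝ => (NormedSpace.exp (t • G) x z : ℂ) * Complex.exp (-(t * c)))
      (G x z - (1 : Matrix n n ℂ) x z * c) 0 := by
  have htransition := (hasDerivAt_exp_smul_apply G x z).ofReal_comp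
  have hdiscount : HasDerivAt (fun t : ℝ => Complex.exp (-(t * c))) (-c) 0 := by
    simpa using ((Complex.ofRealCLM.hasDerivAt (x := 0)).mul_const c).neg.cexp
  refine (htransition.mul hdiscount).congr_deriv ?_
  rcases eq_or_ne x z with rfl | hxz
  · simp [sub_eq_add_neg]
  · simp [hxz]

lemma sum_deriv_mul_eq_zero {n : Type*} [Fintype n] [DecidableEq n] {φ : n → ℝ → ℂ}
    {φ' U : n → ℂ} {u : ℝ≥0 → n → ℂ} {x : n} (hφ : ∀ z, HasDerivAt (φ z) (φ' z) 0)
    (hφ_zero : ∀ z, φ z 0 = (1 : Matrix n n ℂ) x z)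
    (hu : ∀ z, Tendsto (fun h => u h z) (𝓝[>] 0) (𝓝 (U z)))
    (hrec : ∀ h : ℝ≥0, u h x = ∑ z, φ z h * u h z) : ∑ z, φ' z * U z = 0 := by
  have hcoe : Tendsto (fun h : ℝ≥0 => (h : ℝ)) (𝓝[>] 0) (𝓝[>] 0) :=
    tendsto_nhdsWithin_iff.2
      ⟨(NNReal.continuous_coe.tendsto' 0 0 rfl).mono_left nhdsWithin_le_nhds,
        eventually_nhdsWithin_of_forall fun _ hh => hh⟩
  have hlim : Tendsto (fun h : ℝ≥0 => ∑ z, ((h : ℝ)⁻¹ • (φ z (0 + h) - φ z 0)) * u h z) (𝓝[>] 0)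
      (𝓝 (∑ z, φ' z * U z)) :=
    tendsto_finsetSum _ fun z _ => ((hφ z).tendsto_slope_zero_right.comp hcoe).mul (hu z)
  have hzero (h : ℝ≥0) : ∑ z, ((h : ℝ)⁻¹ • (φ z (0 + h) - φ z 0)) * u h z = 0 := by
    have hstart : ∑ z, φ z 0 * u h z = u h x := by simp [hφ_zero, Matrix.one_apply]
    simp only [zero_add, smul_mul_assoc, sub_mul, ← Finset.smul_sum, Finset.sum_sub_distrib,
      ← hrec, hstart, sub_self, smul_zero]
  exact tendsto_nhds_unique (hlim.congr hzero) tendsto_const_nhds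

section ExpectedExitPayoff

variable {S : Finset ℝ} {Ω : Type*} [MeasurableSpace Ω] {G : Matrix S S ℝ} {P : S → Measure Ω}
  {Y : ℝ≥0 → Ω → S} {D : Set (S × S)} {κ g : S × S → ℂ} {h : ℝ≥0} {x y : S}

/-- The analogue of `expectedExitPayoff` for the skeleton of the chain with time step `h`. -/
noncomputable def expectedSkeletonPayoff (P : S → Measure Ω) (Y : ℝ≥0 → Ω → S) (h : ℝ≥0)
    (D : Set (S × S)) (κ g : S × S → ℂ) (x y : S) : ℂ :=
  ∫ ω, seqExitPayoff h D κ g (withMax y (skeleton Y h ω)) ∂(P x)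

/-- The expectation of the exit payoff of `(Y, Ȳ)` under the conditions `Y₀ = x` and `Ȳ₀ = y ⊔ x`,
as a function of `x` and `y`. -/
noncomputable def expectedExitPayoff (P : S → Measure Ω) (Y : ℝ≥0 → Ω → S)
    (D : Set (S × S)) (κ g : S × S → ℂ) (x y : S) : ℂ :=
  ∫ ω, exitPayoff D κ g (pathWithMax Y y ω) ∂(P x)

namespace IsCTMC

lemma expectedSkeletonPayoff_eq_sum (hY : IsCTMC G P Y) (hκ : ∀ p, 0 ≤ (κ p).re) (hxy : x ≤ y)
    (hD : (x, y) ∈ D) :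
    expectedSkeletonPayoff P Y h D κ g x y =
      ∑ z, (NormedSpace.exp ((h : ℝ) • G) x z * Complex.exp (-(h * κ (z, y ⊔ z)))) *
        expectedSkeletonPayoff P Y h D κ g z y := by
  let Φ (w : ℕ → S) : ℂ :=
    Complex.exp (-(h * κ (w 0, y ⊔ w 0))) * seqExitPayoff h D κ g (withMax y w)
  have hΦ : Measurable Φ := by
    have hdiscount : Measurable fun w : ℕ → S => Complex.exp (-(h * κ (w 0, y ⊔ w 0))) :=
      (Measurable.of_discrete (f := fun z : S => Complex.exp (-(h * κ (z, y ⊔ z))))).comp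
        (measurable_pi_apply 0)
    exact hdiscount.mul (measurable_seqExitPayoff.comp (measurable_withMax y))
  have hbound (w : ℕ → S) : ‖Φ w‖ ≤ 1 * ‖g‖ := by
    rw [norm_mul]
    gcongr
    · rw [Complex.norm_exp, Real.exp_le_one_iff]
      simpa using mul_nonneg h.coe_nonneg (hκ _)
    · exact norm_seqExitPayoff_le h.coe_nonneg hκ (norm_le_pi_norm g) _
  have hfirst : ∀ᵐ ω ∂(P x), seqExitPayoff h D κ g (withMax y (skeleton Y h ω)) =
      Φ fun j => skeleton Y h ω (j + 1) := by
    filter_upwards [hY.ae_skeleton_zero h x] with ω h0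
    have hmem : withMax y (skeleton Y h ω) 0 ∈ D := by
      simpa [withMax, h0, sup_eq_left.2 hxy] using hD
    rw [seqExitPayoff_of_zero_mem hmem]
    simp only [withMax_succ (h0.trans_le hxy)]
    rfl
  rw [expectedSkeletonPayoff, integral_congr_ae hfirst,
    hY.integral_comp_skeleton_succ h x hΦ hbound]
  refine Finset.sum_congr rfl fun z _ => ?_
  have hdiscount : ∫ ω, Φ (skeleton Y h ω) ∂(P z) =
      Complex.exp (-(h * κ (z, y ⊔ z))) * expectedSkeletonPayoff P Y h D κ g z y := by
    rw [expectedSkeletonPayoff, ← integral_const_mul]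
    refine integral_congr_ae ((hY.ae_skeleton_zero h z).mono fun ω h0 => ?_)
    simp only [Φ, h0]
  rw [hdiscount, mul_assoc]

lemma measurable_skeletonPayoff (hY : IsCTMC G P Y) :
    Measurable fun ω => seqExitPayoff h D κ g (withMax y (skeleton Y h ω)) :=
  measurable_seqExitPayoff.comp ((measurable_withMax y).comp (hY.measurable_skeleton h))

lemma measurable_exitPayoff (hY : IsCTMC G P Y) (hD : ∀ x, IsLowerSet {m | (x, m) ∈ D}) :
    Measurable fun ω => exitPayoff D κ g (pathWithMax Y y ω) :=
  measurable_of_tendsto_metrizable' (𝓝[>] (0 : ℝ≥0))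
    (fun h => hY.measurable_skeletonPayoff (h := h))
    (tendsto_pi_nhds.2 fun ω =>
      tendsto_seqExitPayoff_withMax (hY.rightLocallyConstant ω) y hD κ g)

lemma integrable_exitPayoff (hY : IsCTMC G P Y) (hD : ∀ x, IsLowerSet {m | (x, m) ∈ D})
    (hκ : ∀ p, 0 ≤ (κ p).re) :
    Integrable (fun ω => exitPayoff D κ g (pathWithMax Y y ω)) (P x) :=
  have := hY.isProbabilityMeasure x
  .of_bound (hY.measurable_exitPayoff hD).aestronglyMeasurable ‖g‖
    (.of_forall fun _ => norm_exitPayoff_le hκ (norm_le_pi_norm g))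

lemma tendsto_expectedSkeletonPayoff (hY : IsCTMC G P Y)
    (hD : ∀ x, IsLowerSet {m | (x, m) ∈ D}) (hκ : ∀ p, 0 ≤ (κ p).re) (x y : S) :
    Tendsto (fun h => expectedSkeletonPayoff P Y h D κ g x y) (𝓝[>] 0)
      (𝓝 (expectedExitPayoff P Y D κ g x y)) :=
  have := hY.isProbabilityMeasure x
  tendsto_integral_filter_of_dominated_convergence (fun _ => ‖g‖)
    (.of_forall fun _ => hY.measurable_skeletonPayoff.aestronglyMeasurable)
    (.of_forall fun h => .of_forall fun _ =>
      norm_seqExitPayoff_le h.coe_nonneg hκ (norm_le_pi_norm g) _)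
    (integrable_const _)
    (.of_forall fun ω => tendsto_seqExitPayoff_withMax (hY.rightLocallyConstant ω) y hD κ g)

lemma expectedExitPayoff_sup (hY : IsCTMC G P Y) (x y : S) :
    expectedExitPayoff P Y D κ g x (y ⊔ x) = expectedExitPayoff P Y D κ g x y := by
  refine integral_congr_ae ((hY.ae_eq_start x).mono fun ω h0 => ?_)
  simp only [← h0, pathWithMax_sup_zero]

lemma expectedExitPayoff_of_notMem (hY : IsCTMC G P Y) (hout : (x, y ⊔ x) ∉ D) :
    expectedExitPayoff P Y D κ g x y = g (x, y ⊔ x) := by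
  have := hY.isProbabilityMeasure x
  have hconst : ∀ᵐ ω ∂(P x), exitPayoff D κ g (pathWithMax Y y ω) = g (x, y ⊔ x) := by
    filter_upwards [hY.ae_eq_start x] with ω h0
    have hzero : pathWithMax Y y ω 0 = (x, y ⊔ x) := by rw [pathWithMax, runMax_zero, h0]
    rw [exitPayoff_of_zero_notMem (hzero ▸ hout), hzero]
  rw [expectedExitPayoff, integral_congr_ae hconst, integral_const, probReal_univ, one_smul]

theorem sum_generator_mul_expectedExitPayoff (hY : IsCTMC G P Y)
    (hD : ∀ x, IsLowerSet {m | (x, m) ∈ D}) (hκ : ∀ p, 0 ≤ (κ p).re) (hxy : x ≤ y)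
    (hin : (x, y) ∈ D) :
    ∑ z, (G x z : ℂ) * expectedExitPayoff P Y D κ g z y =
      κ (x, y) * expectedExitPayoff P Y D κ g x y := by
  have hderiv := sum_deriv_mul_eq_zero
    (fun z => hasDerivAt_exp_smul_apply_mul_cexp G x z (κ (z, y ⊔ z)))
    (fun z => by rcases eq_or_ne x z with rfl | hxz <;> simp [*])
    (hY.tendsto_expectedSkeletonPayoff (g := g) hD hκ · y)
    (fun h => hY.expectedSkeletonPayoff_eq_sum hκ hxy hin)
  simpa [sub_mul, Finset.sum_sub_distrib, Matrix.one_apply, sup_eq_left.2 hxy, sub_eq_zero]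
    using hderiv

lemma tendsto_expectedExitPayoff_add_const (hY : IsCTMC G P Y)
    (hD : ∀ x, IsLowerSet {m | (x, m) ∈ D}) (hκ : ∀ p, 0 ≤ (κ p).re) (x y : S) :
    Tendsto (fun δ : ℝ => expectedExitPayoff P Y D (fun p => κ p + δ) g x y) (𝓝[>] 0)
      (𝓝 (expectedExitPayoff P Y D κ g x y)) := by
  have := hY.isProbabilityMeasure x
  refine tendsto_integral_filter_of_dominated_convergence (fun _ => ‖g‖)
    (.of_forall fun _ => (hY.measurable_exitPayoff hD).aestronglyMeasurable) ?_
    (integrable_const _) (.of_forall fun ω => ?_)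
  · filter_upwards [self_mem_nhdsWithin] with δ hδ
    refine .of_forall fun _ => norm_exitPayoff_le (fun p => ?_) (norm_le_pi_norm g)
    simpa using add_nonneg (hκ p) (mem_Ioi.1 hδ).le
  · have hgrid := isGridApprox_pathWithMax (hY.rightLocallyConstant ω) y
    exact (tendsto_exitPayoff_add_const fun b => hgrid.intervalIntegrable_comp κ 0 b).mono_left
      nhdsWithin_le_nhds

end IsCTMC

end ExpectedExitPayoff

section MaximumPrinciple

variable {S : Finset ℝ} {G : Matrix S S ℝ} {A : Set S} {κ u v : S → ℂ}

/-- The functions that solve `G u = κ u` on `A`. -/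
def killedHarmonic (G : Matrix S S ℝ) (A : Set S) (κ : S → ℂ) : Submodule ℂ (S → ℂ) where
  carrier := {u | ∀ x ∈ A, ∑ z, (G x z : ℂ) * u z = κ x * u x}
  add_mem' hu hv x hx := by
    simp only [Pi.add_apply, mul_add, Finset.sum_add_distrib, hu x hx, hv x hx]
  zero_mem' x _ := by simp
  smul_mem' c u hu x hx := by
    simp only [Pi.smul_apply, smul_eq_mul, mul_left_comm _ c, ← Finset.mul_sum, hu x hx]

lemma IsRateMatrix.sum_norm_erase (hG : IsRateMatrix G) (x : S) :
    ∑ z ∈ Finset.univ.erase x, ‖(G x z : ℂ)‖ = -G x x := by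
  rw [hG.diag_eq, neg_neg]
  refine Finset.sum_congr rfl fun z hz => ?_
  rw [Complex.norm_of_nonneg (hG.offDiag_nonneg x z (Finset.ne_of_mem_erase hz).symm)]

lemma IsRateMatrix.eq_zero_of_mem_killedHarmonic (hG : IsRateMatrix G) (hκ : ∀ x ∈ A, 0 < (κ x).re)
    (hu : u ∈ killedHarmonic G A κ) (hu_out : ∀ x ∉ A, u x = 0) : u = 0 := by
  classical
  let M : Matrix S S ℂ :=
    .of fun x z => if x ∈ A then (if x = z then κ x else 0) - G x z else (1 : Matrix S S ℂ) x z
  have hdominant (x : S) : ∑ z ∈ Finset.univ.erase x, ‖M x z‖ < ‖M x x‖ := by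
    by_cases hx : x ∈ A
    · calc ∑ z ∈ Finset.univ.erase x, ‖M x z‖
          = ∑ z ∈ Finset.univ.erase x, ‖(G x z : ℂ)‖ :=
            Finset.sum_congr rfl fun z hz => by simp [M, hx, (Finset.ne_of_mem_erase hz).symm]
        _ = -G x x := hG.sum_norm_erase x
        _ < (κ x - G x x).re := by simpa using hκ x hx
        _ ≤ ‖κ x - G x x‖ := Complex.re_le_norm _
        _ = ‖M x x‖ := by simp [M, hx]
    · have hrow : ∀ z ∈ Finset.univ.erase x, ‖M x z‖ = 0 := fun z hz => by
        simp [M, hx, (Finset.ne_of_mem_erase hz).symm]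
      rw [Finset.sum_eq_zero hrow]
      simp [M, hx]
  refine Matrix.eq_zero_of_mulVec_eq_zero (det_ne_zero_of_sum_row_lt_diag hdominant) ?_
  ext x
  by_cases hx : x ∈ A
  · have hrow : ∑ z, M x z * u z = κ x * u x - ∑ z, (G x z : ℂ) * u z := by
      simp [M, hx, sub_mul, Finset.sum_sub_distrib]
    exact hrow.trans (sub_eq_zero.2 (hu x hx).symm)
  · simp [M, hx, Matrix.mulVec, dotProduct, Matrix.one_apply, hu_out]

lemma IsRateMatrix.eq_of_mem_killedHarmonic (hG : IsRateMatrix G) (hκ : ∀ x ∈ A, 0 < (κ x).re)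
    (hu : u ∈ killedHarmonic G A κ) (hv : v ∈ killedHarmonic G A κ) (huv : ∀ x ∉ A, u x = v x) :
    u = v :=
  sub_eq_zero.1 <| hG.eq_zero_of_mem_killedHarmonic hκ (sub_mem hu hv) fun x hx =>
    sub_eq_zero.2 (huv x hx)

lemma IsCTMC.expectedExitPayoff_mem_killedHarmonic {Ω : Type*} [MeasurableSpace Ω]
    {P : S → Measure Ω} {Y : ℝ≥0 → Ω → S} (hY : IsCTMC G P Y) {D : Set (S × S)}
    (hD : ∀ x, IsLowerSet {m | (x, m) ∈ D}) {κ : S × S → ℂ} (hκ : ∀ p, 0 ≤ (κ p).re)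
    (g : S × S → ℂ) {y : S} (hA : ∀ z ∈ A, z ≤ y ∧ (z, y) ∈ D) :
    (expectedExitPayoff P Y D κ g · y) ∈ killedHarmonic G A (fun z => κ (z, y)) :=
  fun z hz => hY.sum_generator_mul_expectedExitPayoff hD hκ (hA z hz).1 (hA z hz).2

end MaximumPrinciple

section Domains

variable {S : Finset ℝ}

/-- The pairs (position, running maximum) with position in `A`; the exit time of `(Y, Ȳ)` is then
the first passage time `T_A`. -/
def positionIn (S : Finset ℝ) (A : Set ℝ) : Set (S × S) :=
  {p | (p.1 : ℝ) ∈ A}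

/-- The pairs (position, running maximum) with drawdown smaller than `a`; the exit time of `(Y, Ȳ)`
is then the drawdown time `τ_a`. -/
def drawdownLT (S : Finset ℝ) (a : ℝ) : Set (S × S) :=
  {p | (p.2 : ℝ) - p.1 < a}

lemma isLowerSet_positionIn (A : Set ℝ) (x : S) : IsLowerSet {m | (x, m) ∈ positionIn S A} :=
  fun _ _ _ hx => hx

lemma isLowerSet_drawdownLT (a : ℝ) (x : S) : IsLowerSet {m | (x, m) ∈ drawdownLT S a} :=
  fun _ _ hle hm => (sub_le_sub_right (Subtype.coe_le_coe.2 hle) _).trans_lt hm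

end Domains

section Identification

variable {S : Finset ℝ} {Ω : Type*} {Y : ℝ≥0 → Ω → S} {ω : Ω}

lemma passageTime_eq_exitTime (hω : RightLocallyConstant fun t => Y t ω) (A : Set ℝ) (y : S) :
    passageTime Y A ω = exitTime (positionIn S A) (pathWithMax Y y ω) := by
  refine le_antisymm (le_sInf ?_) (sInf_le_sInf (image_mono fun _ ht => ht.2))
  rintro _ ⟨t, ht, rfl⟩
  refine le_of_forall_gt_imp_ge_of_dense fun b hb => ?_
  obtain ⟨u, hu, hconst⟩ := mem_nhdsGE_iff_exists_Ico_subset.1 (hω t)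
  obtain ⟨s, hts, hs⟩ := ENNReal.lt_iff_exists_nnreal_btwn.1
    (lt_min hb (ENNReal.coe_lt_coe.2 hu))
  rw [ENNReal.coe_lt_coe] at hts
  obtain ⟨hsb, hsu⟩ := lt_min_iff.1 hs
  have heq : Y s ω = Y t ω := hconst ⟨hts.le, ENNReal.coe_lt_coe.1 hsu⟩
  refine sInf_le_of_le ⟨s, ⟨pos_of_gt hts, ?_⟩, rfl⟩ hsb.le
  rw [heq]
  exact ht

lemma passageVar_eq_exitPayoff (hω : RightLocallyConstant fun t => Y t ω) (A : Set ℝ)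
    (κ : S → ℂ) (f : S → ℝ) (y : S) :
    passageVar Y A κ f ω =
      exitPayoff (positionIn S A) (fun p => κ p.1) (fun p => (f p.1 : ℂ)) (pathWithMax Y y ω) := by
  rw [passageVar, exitPayoff, passageTime_eq_exitTime hω A y]
  rfl

lemma drawdownVar_eq_exitPayoff (Y : ℝ≥0 → Ω → S) (y : S) (a : ℝ) (k : S → S → ℂ) (f : S → ℝ)
    (ω : Ω) :
    drawdownVar Y y a k f ω =
      exitPayoff (drawdownLT S a) (Function.uncurry k) (fun p => (f p.1 : ℂ))
        (pathWithMax Y y ω) := by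
  have htime : drawdownTime Y y a ω = exitTime (drawdownLT S a) (pathWithMax Y y ω) := by
    simp only [drawdownTime, exitTime, drawdownLT, pathWithMax, mem_ofPred_eq, not_lt]
  rw [drawdownVar, exitPayoff, htime]
  rfl

lemma upTime_of_isLeast (hω : RightLocallyConstant fun t => Y t ω) {l r : ℝ} {T : ℝ≥0}
    (hT : IsLeast {t | (Y t ω : ℝ) ∉ Ioc l r} T) (hr : r < Y T ω) : upTime Y r ω = T := by
  rw [upTime, passageTime_eq_exitTime hω _ (Y 0 ω)]
  exact exitTime_of_isLeast ⟨not_le.2 hr, fun t ht => hT.2 fun hmem => ht hmem.2⟩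

lemma upTime_lt_downTime_iff (hω : RightLocallyConstant fun t => Y t ω) {l r : ℝ} (hlr : l < r)
    {T : ℝ≥0} (hT : IsLeast {t | (Y t ω : ℝ) ∉ Ioc l r} T) :
    upTime Y r ω < downTime Y l ω ↔ r < Y T ω := by
  have hmax := rightLocallyConstant_pathWithMax hω (Y 0 ω)
  by_cases hr : r < Y T ω
  · have hdown : ∀ t ≤ T, l < Y t ω := fun t ht => by
      rcases ht.lt_or_eq with htT | rfl
      · exact (not_not.1 fun hout => (hT.2 hout).not_gt htT : (Y t ω : ℝ) ∈ Ioc l r).1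
      · exact hlr.trans hr
    rw [upTime_of_isLeast hω hT hr, downTime, passageTime_eq_exitTime hω _ (Y 0 ω)]
    exact iff_of_true (hmax.lt_exitTime_iff.2 hdown) hr
  · have hl : (Y T ω : ℝ) ∉ Ioi l := fun hl => hT.1 ⟨hl, not_lt.1 hr⟩
    rw [upTime, downTime, passageTime_eq_exitTime hω _ (Y 0 ω),
      passageTime_eq_exitTime hω _ (Y 0 ω)]
    have hdown : exitTime (positionIn S (Ioi l)) (pathWithMax Y (Y 0 ω) ω) = T :=
      exitTime_of_isLeast ⟨hl, fun t ht => hT.2 fun hmem => ht hmem.1⟩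
    have hup : (T : ℝ≥0∞) ≤ exitTime (positionIn S (Iic r)) (pathWithMax Y (Y 0 ω) ω) :=
      (exitTime_of_isLeast (D := positionIn S (Ioc l r)) hT).symm.trans_le
        (exitTime_mono fun _ hp => hp.2)
    exact iff_of_false (hdown.trans_le hup).not_gt hr

lemma upcrossVar_eq_exitPayoff (hω : RightLocallyConstant fun t => Y t ω) {l r : ℝ} (hlr : l < r)
    (y : S) (k : S → S → ℂ) (g : S → ℝ) :
    upcrossVar Y y l r k g ω =
      exitPayoff (positionIn S (Ioc l r)) (Function.uncurry k)
        (fun p => if r < p.1 then (g p.1 : ℂ) else 0) (pathWithMax Y y ω) := by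
  by_cases hex : ∃ t, Y t ω ∉ {x : S | (x : ℝ) ∈ Ioc l r}
  · obtain ⟨T, hT⟩ := hω.exists_isLeast hex
    have hT' : IsLeast {t | pathWithMax Y y ω t ∉ positionIn S (Ioc l r)} T := hT
    rw [exitPayoff_of_isLeast hT', upcrossVar]
    by_cases hr : r < Y T ω
    · rw [if_pos ((upTime_lt_downTime_iff hω hlr hT).2 hr), upTime_of_isLeast hω hT hr,
        ENNReal.coe_toReal, ENNReal.toNNReal_coe, if_pos (c := r < (pathWithMax Y y ω T).1) hr]
      rfl
    · rw [if_neg (mt (upTime_lt_downTime_iff hω hlr hT).1 hr),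
        if_neg (c := r < (pathWithMax Y y ω T).1) hr, mul_zero]
  · have hin : ∀ t, (Y t ω : ℝ) ∈ Ioc l r := by simpa using hex
    have hup : upTime Y r ω = ∞ := by
      rw [upTime, passageTime_eq_exitTime hω _ y]
      exact exitTime_of_forall_mem fun t => (hin t).2
    rw [upcrossVar, hup, if_neg not_top_lt]
    exact (exitPayoff_of_forall_mem (w := pathWithMax Y y ω) hin).symm

end Identification

section LinearSystem

variable {S : Finset ℝ} {Ω : Type*} [MeasurableSpace Ω] {G : Matrix S S ℝ}
  {P : S → Measure Ω} {Y : ℝ≥0 → Ω → S} {k : S → S → ℂ} {a l r : ℝ} {x : S}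

namespace IsCTMC

lemma integrable_passageVar (hY : IsCTMC G P Y) {κ : S → ℂ} (hκ : ∀ z, 0 ≤ (κ z).re) (A : Set ℝ)
    (f : S → ℝ) (x : S) : Integrable (passageVar Y A κ f) (P x) := by
  simp only [funext fun ω => passageVar_eq_exitPayoff (hY.rightLocallyConstant ω) A κ f x]
  exact hY.integrable_exitPayoff (isLowerSet_positionIn A) fun p => hκ p.1

lemma integrable_drawdownVar (hY : IsCTMC G P Y) (hk : ∀ z m, 0 ≤ (k z m).re) (a : ℝ)
    (f : S → ℝ) (x y : S) : Integrable (drawdownVar Y y a k f) (P x) := by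
  simp only [funext (drawdownVar_eq_exitPayoff Y y a k f)]
  exact hY.integrable_exitPayoff (isLowerSet_drawdownLT a) fun p => hk p.1 p.2

lemma integrable_upcrossVar (hY : IsCTMC G P Y) (hk : ∀ z m, 0 ≤ (k z m).re) (hlr : l < r)
    (g : S → ℝ) (x y : S) : Integrable (upcrossVar Y y l r k g) (P x) := by
  simp only [funext fun ω => upcrossVar_eq_exitPayoff (hY.rightLocallyConstant ω) hlr y k g]
  exact hY.integrable_exitPayoff (isLowerSet_positionIn _) fun p => hk p.1 p.2

lemma passageP_eq_expectedExitPayoff (hY : IsCTMC G P Y) (A : Set ℝ) (κ : S → ℂ) (f : S → ℝ)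
    (x y : S) :
    passageP P Y A κ x f =
      expectedExitPayoff P Y (positionIn S A) (fun p => κ p.1) (fun p => (f p.1 : ℂ)) x y :=
  integral_congr_ae (.of_forall fun ω =>
    passageVar_eq_exitPayoff (hY.rightLocallyConstant ω) A κ f y)

lemma upcrossS_eq_expectedExitPayoff (hY : IsCTMC G P Y) (hlr : l < r) (k : S → S → ℂ)
    (x y : S) (g : S → ℝ) :
    upcrossS P Y l r k x y g =
      expectedExitPayoff P Y (positionIn S (Ioc l r)) (Function.uncurry k)
        (fun p => if r < p.1 then (g p.1 : ℂ) else 0) x y :=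
  integral_congr_ae (.of_forall fun ω =>
    upcrossVar_eq_exitPayoff (hY.rightLocallyConstant ω) hlr y k g)

lemma passageP_of_notMem (hY : IsCTMC G P Y) {A : Set ℝ} (hx : (x : ℝ) ∉ A) (κ : S → ℂ)
    (f : S → ℝ) : passageP P Y A κ x f = f x :=
  (hY.passageP_eq_expectedExitPayoff A κ f x x).trans
    (hY.expectedExitPayoff_of_notMem hx)

lemma upcrossS_of_notMem (hY : IsCTMC G P Y) (hlr : l < r) (hx : (x : ℝ) ∉ Ioc l r)
    (k : S → S → ℂ) (y : S) (g : S → ℝ) :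
    upcrossS P Y l r k x y g = if r < (x : ℝ) then (g x : ℂ) else 0 :=
  (hY.upcrossS_eq_expectedExitPayoff hlr k x y g).trans
    (hY.expectedExitPayoff_of_notMem hx)

theorem sum_generator_mul_upcrossS (hY : IsCTMC G P Y) (hk : ∀ z m, 0 ≤ (k z m).re) (hlr : l < r)
    {y : S} (hxy : x ≤ y) (hx : (x : ℝ) ∈ Ioc l r) (g : S → ℝ) :
    ∑ z, (G x z : ℂ) * upcrossS P Y l r k z (y ⊔ z) g = k x y * upcrossS P Y l r k x y g := by
  simp only [hY.upcrossS_eq_expectedExitPayoff hlr, hY.expectedExitPayoff_sup]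
  exact hY.sum_generator_mul_expectedExitPayoff (isLowerSet_positionIn _) (fun p => hk p.1 p.2)
    hxy hx

lemma passageP_mem_killedHarmonic (hY : IsCTMC G P Y) {κ : S → ℂ} (hκ : ∀ z, 0 ≤ (κ z).re)
    (f : S → ℝ) (l : ℝ) (x : S) :
    (passageP P Y (Ioc l x) κ · f) ∈ killedHarmonic G {z : S | (z : ℝ) ∈ Ioc l x} κ := by
  simp only [fun z => hY.passageP_eq_expectedExitPayoff (Ioc l x) κ f z x]
  exact hY.expectedExitPayoff_mem_killedHarmonic (isLowerSet_positionIn _) (fun p => hκ p.1) _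
    fun z hz => ⟨hz.2, hz⟩

lemma upcrossS_mem_killedHarmonic (hY : IsCTMC G P Y) (hk : ∀ z m, 0 ≤ (k z m).re)
    (hlx : l < x) (g : S → ℝ) :
    (upcrossS P Y l x k · x g) ∈ killedHarmonic G {z : S | (z : ℝ) ∈ Ioc l x} (k · x) := by
  simp only [hY.upcrossS_eq_expectedExitPayoff hlx]
  exact hY.expectedExitPayoff_mem_killedHarmonic (isLowerSet_positionIn _) (fun p => hk p.1 p.2) _
    fun z hz => ⟨hz.2, hz⟩

lemma drawdownC_eq_expectedExitPayoff (P : S → Measure Ω) (Y : ℝ≥0 → Ω → S) (a : ℝ)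
    (f : S → ℝ) (k : S → S → ℂ) (x : S) :
    drawdownC P Y a f k x =
      expectedExitPayoff P Y (drawdownLT S a) (Function.uncurry k) (fun p => (f p.1 : ℂ)) x x :=
  integral_congr_ae (.of_forall (drawdownVar_eq_exitPayoff Y x a k f))

lemma expectedDrawdown_of_notMem (hY : IsCTMC G P Y) (a : ℝ) (f : S → ℝ) (k : S → S → ℂ)
    {z : S} (hz : (z : ℝ) ∉ Ioc (x - a) x) :
    expectedExitPayoff P Y (drawdownLT S a) (Function.uncurry k) (fun p => (f p.1 : ℂ)) z x =
      if x < z then drawdownC P Y a f k z else f z := by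
  rw [← hY.expectedExitPayoff_sup]
  split_ifs with hxz
  · rw [sup_eq_right.2 hxz.le, drawdownC_eq_expectedExitPayoff]
  · have hzx : z ≤ x := not_lt.1 hxz
    have hza : (z : ℝ) ≤ x - a := not_lt.1 fun hza => hz ⟨hza, hzx⟩
    have hout : (z, x ⊔ z) ∉ drawdownLT S a := by
      rw [sup_eq_left.2 hzx]
      exact not_lt.2 (le_sub_comm.1 hza)
    rw [hY.expectedExitPayoff_sup, hY.expectedExitPayoff_of_notMem hout]

lemma passageP_add_sum_upcrossS_of_notMem (hY : IsCTMC G P Y) (hlx : l < x) {z : S}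
    (hz : (z : ℝ) ∉ Ioc l x) (k : S → S → ℂ) (f : S → ℝ) (c : S → ℂ) :
    passageP P Y (Ioc l x) (k · x) z (fun z => if (z : ℝ) ≤ l then f z else 0) +
        ∑ v : S with x < v, upcrossS P Y l x k z x (fun w => if w = v then 1 else 0) * c v =
      if x < z then c z else f z := by
  simp only [hY.passageP_of_notMem hz, hY.upcrossS_of_notMem hlx hz, Subtype.coe_lt_coe]
  split_ifs with hzl hxz hxz
  · exact absurd (hlx.trans (Subtype.coe_lt_coe.2 hxz)) hzl.not_gt
  · simp
  · simp [apply_ite, hxz]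
  · exact absurd ⟨not_le.1 hzl, not_lt.1 hxz⟩ hz

lemma drawdownC_eq_of_re_pos (hY : IsCTMC G P Y) (hk : ∀ z m, 0 < (k z m).re) (ha : 0 < a)
    (f : S → ℝ) (x : S) :
    drawdownC P Y a f k x =
      passageP P Y (Ioc ((x : ℝ) - a) x) (fun z => k z x) x
          (fun z => if (z : ℝ) ≤ (x : ℝ) - a then f z else 0) +
        ∑ v : S with x < v,
          upcrossS P Y ((x : ℝ) - a) x k x x (fun w => if w = v then 1 else 0) *
            drawdownC P Y a f k v := by
  have hk' (z m : S) : 0 ≤ (k z m).re := (hk z m).le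
  have hlx : (x : ℝ) - a < x := sub_lt_self _ ha
  have hdrawdown : (expectedExitPayoff P Y (drawdownLT S a) (Function.uncurry k)
      (fun p => (f p.1 : ℂ)) · x) ∈ killedHarmonic G {z : S | (z : ℝ) ∈ Ioc (x - a) x} (k · x) :=
    hY.expectedExitPayoff_mem_killedHarmonic (isLowerSet_drawdownLT a) (fun p => hk' p.1 p.2) _
      fun z hz => ⟨hz.2, sub_lt_comm.1 hz.1⟩
  have hpassage := hY.passageP_mem_killedHarmonic (hk' · x)
    (fun z => if (z : ℝ) ≤ (x : ℝ) - a then f z else 0) (x - a) x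
  have hupcross (v : S) := hY.upcrossS_mem_killedHarmonic hk' hlx (fun w => if w = v then 1 else 0)
  have hsum := add_mem hpassage (sum_mem (t := Finset.univ.filter (x < ·)) fun v _ =>
    Submodule.smul_mem _ (drawdownC P Y a f k v) (hupcross v))
  rw [drawdownC_eq_expectedExitPayoff]
  refine (congrFun (hY.isRateMatrix.eq_of_mem_killedHarmonic (fun z _ => hk z x) hdrawdown hsum
    fun z hz => ?_) x).trans ?_
  · rw [hY.expectedDrawdown_of_notMem a f k hz]
    simpa [mul_comm] using (hY.passageP_add_sum_upcrossS_of_notMem hlx hz k f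
      (drawdownC P Y a f k)).symm
  · simp [mul_comm]

theorem drawdownC_eq_passageP_add_sum (hY : IsCTMC G P Y) (hk : ∀ z m, 0 ≤ (k z m).re) (ha : 0 < a)
    (f : S → ℝ) (x : S) :
    drawdownC P Y a f k x =
      passageP P Y (Ioc ((x : ℝ) - a) x) (fun z => k z x) x
          (fun z => if (z : ℝ) ≤ (x : ℝ) - a then f z else 0) +
        ∑ v : S with x < v,
          upcrossS P Y ((x : ℝ) - a) x k x x (fun w => if w = v then 1 else 0) *
            drawdownC P Y a f k v := by
  have hdrawdown (v : S) : Tendsto (fun δ : ℝ => drawdownC P Y a f (fun z m => k z m + δ) v)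
      (𝓝[>] 0) (𝓝 (drawdownC P Y a f k v)) := by
    simp only [drawdownC_eq_expectedExitPayoff]
    exact hY.tendsto_expectedExitPayoff_add_const (isLowerSet_drawdownLT a)
      (fun p => hk p.1 p.2) v v
  have hpassage (f' : S → ℝ) : Tendsto
      (fun δ : ℝ => passageP P Y (Ioc ((x : ℝ) - a) x) (fun z => k z x + δ) x f')
      (𝓝[>] 0) (𝓝 (passageP P Y (Ioc ((x : ℝ) - a) x) (fun z => k z x) x f')) := by
    simp only [fun κ => hY.passageP_eq_expectedExitPayoff (Ioc ((x : ℝ) - a) x) κ f' x x]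
    exact hY.tendsto_expectedExitPayoff_add_const (isLowerSet_positionIn _)
      (fun p => hk p.1 x) x x
  have hupcross (g : S → ℝ) : Tendsto
      (fun δ : ℝ => upcrossS P Y (x - a) x (fun z m => k z m + δ) x x g)
      (𝓝[>] 0) (𝓝 (upcrossS P Y (x - a) x k x x g)) := by
    simp only [hY.upcrossS_eq_expectedExitPayoff (sub_lt_self (x : ℝ) ha)]
    exact hY.tendsto_expectedExitPayoff_add_const (isLowerSet_positionIn _)
      (fun p => hk p.1 p.2) x x
  refine tendsto_nhds_unique (hdrawdown x) (((hpassage _).add (tendsto_finsetSum _ fun v _ =>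
    (hupcross _).mul (hdrawdown v))).congr' ?_)
  filter_upwards [self_mem_nhdsWithin] with δ hδ
  refine (hY.drawdownC_eq_of_re_pos (k := fun z m => k z m + δ) (fun z m => ?_) ha f x).symm
  simpa using add_pos_of_nonneg_of_pos (hk z m) hδ

end IsCTMC

end LinearSystem

end DrawdownCTMC

theorem mainTheorem4 {S : Finset ℝ} {Ω : Type*} [MeasurableSpace Ω] (G : Matrix S S ℝ)
    (P : S → Measure Ω) (Y : ℝ≥0 → Ω → S) (hY : IsCTMC G P Y)
    (a : ℝ) (ha : 0 < a) (f : S → ℝ)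
    (k : S → S → ℂ) (hk : ∀ x y, 0 ≤ (k x y).re) :
    -- the linear system for `C` (with the expectations in it well defined)
    (∀ x : S,
      Integrable (drawdownVar Y x a k f) (P x) ∧
      Integrable (passageVar Y (Ioc ((x : ℝ) - a) x) (fun z => k z x)
        (fun z => if (z : ℝ) ≤ (x : ℝ) - a then f z else 0)) (P x) ∧
      drawdownC P Y a f k x =
        passageP P Y (Ioc ((x : ℝ) - a) x) (fun z => k z x) x
            (fun z => if (z : ℝ) ≤ (x : ℝ) - a then f z else 0) +
          ∑ z : S with x < z,
            upcrossS P Y ((x : ℝ) - a) x k x x (fun w => if w = z then 1 else 0) *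
              drawdownC P Y a f k z) ∧
    -- the linear system for `S_{(l, r]}` (with the expectations in it well defined)
    (∀ (l r : ℝ), l < r → ∀ (g : S → ℝ) (x y : S), x ≤ y →
      Integrable (upcrossVar Y y l r k g) (P x) ∧
      ((x : ℝ) ∈ Ioc l r →
        k x y * upcrossS P Y l r k x y g -
          ∑ z : S, (G x z : ℂ) * upcrossS P Y l r k z (y ⊔ z) g = 0) ∧
      ((x : ℝ) ∉ Ioc l r →
        upcrossS P Y l r k x y g = if r < (x : ℝ) then (g x : ℂ) else 0)) := by
  refine ⟨fun x => ⟨hY.integrable_drawdownVar hk a f x x, hY.integrable_passageVar (hk · x) _ _ x,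
    hY.drawdownC_eq_passageP_add_sum hk ha f x⟩, fun l r hlr g x y hxy =>
    ⟨hY.integrable_upcrossVar hk hlr g x y, fun hx => ?_,
      fun hx => hY.upcrossS_of_notMem hlr hx k y g⟩⟩
  rw [hY.sum_generator_mul_upcrossS hk hlr hxy hx, sub_self]
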